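/- Assume the Generalized Riemann Hypothesis for Dirichlet $L$-functions: for every primitive Dirichlet character $\chi$ (including the trivial character modulo $1$, for which $L(s,\chi)=\zeta(s)$), every zero of $L(s,\chi)$ with $0<\Re s<1$ satisfies $\Re s=\tfrac12$. Let $T\ge 0$. Then: (i) there is a constant $C=C(T)$ such that for every integer $N>1$, every primitive Dirichlet character $\chi$ modulo $N$, and every $s\in\mathbb{C}$ with $\Re s=1$ and $|\Im s|\le T$, $$\left|\frac{L'(s,\chi)}{L(s,\chi)}\right|\le C\,\log\log N;$$ (ii) for every $\varepsilon>0$ there is a constant $C=C(T,\varepsilon)$ such that for every integer $N>1$, every primitive Dirichlet character $\chi$ modulo $N$, and every $s\in\mathbb{C}$ with $\Re s=1$ and $|\Im s|\le T$, $$\left|\frac{L''(s,\chi)}{L(s,\chi)}\right|\le C\,(\log\log N)^{3+\varepsilon}.$$ Here $L'$ and $L''$ are the first and second derivatives of $L(s,\chi)$ with respect to $s$. (There are no primitive characters modulo $2$, so $N\ge 3$ and $\log\log N>0$ whenever the bounds apply.) -/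

import Mathlib

/-- The Generalized Riemann Hypothesis for Dirichlet `L`-functions: for every primitive Dirichlet
character `χ` (the trivial character modulo `1`, with `L(s, χ) = ζ(s)`, included), all zeros of the
analytically continued `L(s, χ)` in the open critical strip lie on the line `Re s = 1/2`. -/
def GeneralizedRiemannHypothesis : Prop :=
  ∀ (N : ℕ) [NeZero N] (χ : DirichletCharacter ℂ N), χ.IsPrimitive →
    ∀ s : ℂ, 0 < s.re → s.re < 1 → DirichletCharacter.LFunction χ s = 0 → s.re = 1 / 2

open Complex Filter Topology Set Metric MeasureTheory

/-! Under GRH, `L'/L` is holomorphic on `Re s > 1/2`. It is compared on two circles about `c = 2 +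
it`. On the circle of radius `5/4`, Borel–Carathéodory applied to `log L` gives `O(log N)`, since
`L` is polynomially bounded in `N` and `1/L(c)` is bounded. On the circle of radius `1 - δ`,
absolute convergence gives `O(1/δ)`. With `δ = 1/(8 + log log N)`, points with `|Re s - 1| ≤ δ` have
three-circles exponent `θ = O(δ)`. Hence `(log N)^θ = O(1)` and `L'/L = O(log log N)` there.

Cauchy's estimate on a disc of radius `δ` then gives `(L'/L)' = O((log log N)^2)`, and `L''/L =
(L'/L)' + (L'/L)^2`. This yields exponent 2, better than the required `3 + ε`. -/

/-! ### Two facts from complex analysis -/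

/-- **Hadamard three circles theorem.** -/
theorem Complex.norm_le_of_three_circles {f : ℂ → ℂ} {c : ℂ} {r₁ r₃ a b : ℝ}
    (hf : DifferentiableOn ℂ f (closedBall c r₃)) (h₁ : 0 < r₁) (h₁₃ : r₁ < r₃)
    (ha : ∀ z ∈ sphere c r₁, ‖f z‖ ≤ a)
    (hb : ∀ z ∈ sphere c r₃, ‖f z‖ ≤ b) {z : ℂ} (hz₁ : r₁ ≤ ‖z - c‖) (hz₃ : ‖z - c‖ ≤ r₃) :
    ‖f z‖ ≤ a ^ (1 - Real.log (‖z - c‖ / r₁) / Real.log (r₃ / r₁)) *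
      b ^ (Real.log (‖z - c‖ / r₁) / Real.log (r₃ / r₁)) := by
  have h₃ : 0 < r₃ := h₁.trans h₁₃
  have hz₀ : 0 < ‖z - c‖ := h₁.trans_le hz₁
  have hlog : Real.log r₁ < Real.log r₃ := Real.log_lt_log h₁ h₁₃
  -- The map `w ↦ c + exp w` carries vertical lines to circles, reducing the claim to the three
  -- lines theorem.
  have hexp (w : ℂ) : c + exp w ∈ sphere c (Real.exp w.re) := by simp [norm_exp]
  have hmem : ∀ w ∈ HadamardThreeLines.verticalClosedStrip (Real.log r₁) (Real.log r₃),
      c + exp w ∈ closedBall c r₃ := by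
    intro w hw
    refine sphere_subset_closedBall.trans (closedBall_subset_closedBall ?_) (hexp w)
    rw [← Real.exp_log h₃]
    exact Real.exp_le_exp.mpr hw.2
  have hdiff : DifferentiableOn ℂ (fun w ↦ f (c + exp w))
      ((fun w ↦ c + exp w) ⁻¹' closedBall c r₃) :=
    hf.comp (by fun_prop) fun w hw ↦ hw
  have hclos : closure (HadamardThreeLines.verticalStrip (Real.log r₁) (Real.log r₃)) ⊆
      (fun w ↦ c + exp w) ⁻¹' closedBall c r₃ := by
    rw [HadamardThreeLines.verticalStrip, closure_preimage_re, closure_Ioo hlog.ne]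
    exact fun w hw ↦ hmem w hw
  have key := HadamardThreeLines.norm_le_interp_of_mem_verticalClosedStrip'
    (f := fun w ↦ f (c + exp w))
    (l := Real.log r₁) (u := Real.log r₃) (a := a) (b := b) (z := log (z - c)) hlog
    ⟨by simpa [log_re] using Real.log_le_log h₁ hz₁, by simpa [log_re] using Real.log_le_log hz₀ hz₃⟩
    (hdiff.mono hclos).diffContOnCl ?_ ?_ ?_
  · rw [exp_log (by rwa [← norm_pos_iff]), add_sub_cancel, log_re,
      ← Real.log_div hz₀.ne' h₁.ne', ← Real.log_div h₃.ne' h₁.ne'] at key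
    exact key
  · obtain ⟨B, hB⟩ := (isCompact_closedBall c r₃).exists_bound_of_continuousOn
      hf.continuousOn
    refine ⟨B, ?_⟩
    rintro _ ⟨w, hw, rfl⟩
    exact hB _ (hmem w hw)
  · intro w hw
    refine ha _ ?_
    have := hexp w
    rwa [show w.re = Real.log r₁ from hw, Real.exp_log h₁] at this
  · intro w hw
    refine hb _ ?_
    have := hexp w
    rwa [show w.re = Real.log r₃ from hw, Real.exp_log h₃] at this

/-- A holomorphic function without zeros on a disc that does not grow much
has a small logarithmic derivative. -/
theorem Complex.norm_deriv_div_le_of_ball {g : ℂ → ℂ} {c : ℂ} {R r M : ℝ}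
    (hg : DifferentiableOn ℂ g (ball c R)) (hg₀ : ∀ z ∈ ball c R, g z ≠ 0) (hM : 0 < M)
    (hgM : ∀ z ∈ ball c R, ‖g z‖ ≤ Real.exp M * ‖g c‖) (hr : 0 ≤ r) (hrR : r < R)
    {z : ℂ} (hz : z ∈ closedBall c r) :
    ‖deriv g z / g z‖ ≤ 8 * M * R / (R - r) ^ 2 := by
  have hR : 0 < R := hr.trans_lt hrR
  have hc : c ∈ ball c R := mem_ball_self hR
  have hdiv : DifferentiableOn ℂ (fun z ↦ deriv g z / g z) (ball c R) :=
    (hg.deriv isOpen_ball).div hg hg₀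
  -- `h` is a holomorphic branch of `log (g / g c)`, so the growth hypothesis becomes `Re h ≤ M`.
  obtain ⟨h, hhc, hh⟩ := hdiv.isExactOn_ball.with_val_at c 0
  have hgh : ∀ w ∈ ball c R, g w = g c * exp (h w) := by
    have hd : ∀ w ∈ ball c R, HasDerivAt (fun w ↦ g w * exp (-h w)) 0 w := by
      intro w hw
      have h1 := (hg.differentiableAt (isOpen_ball.mem_nhds hw)).hasDerivAt
      convert! h1.mul (hh w hw).neg.cexp using 1
      field_simp [hg₀ w hw]
      ring
    intro w hw
    have := isOpen_ball.is_const_of_deriv_eq_zero (convex_ball c R).isPreconnected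
      (fun w hw ↦ (hd w hw).differentiableAt.differentiableWithinAt)
      (fun w hw ↦ (hd w hw).deriv) hw hc
    simp only [hhc, neg_zero, exp_zero, mul_one] at this
    rw [← this, mul_assoc, ← exp_add]
    simp
  have hre : ∀ w ∈ ball c R, (h w).re ≤ M := by
    intro w hw
    have h1 := hgM w hw
    rw [hgh w hw, norm_mul, mul_comm, norm_exp] at h1
    exact Real.exp_le_exp.mp (le_of_mul_le_mul_right h1 (norm_pos_iff.mpr (hg₀ c hc)))
  -- Half of the gap is spent on Borel–Carathéodory, half on Cauchy's estimate.
  set ρ := (R - r) / 2 with hρ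
  have hρ₀ : 0 < ρ := by simp only [hρ]; linarith
  have hhd : DifferentiableOn ℂ h (ball c R) :=
    fun w hw ↦ (hh w hw).differentiableAt.differentiableWithinAt
  have hball : ∀ w ∈ closedBall z ρ, ‖w - c‖ ≤ R - ρ := by
    intro w hw
    have h1 : dist w c ≤ dist w z + dist z c := dist_triangle _ _ _
    rw [mem_closedBall] at hw hz
    rw [← dist_eq_norm]
    linarith
  have hin : ∀ w ∈ closedBall z ρ, w ∈ ball c R := by
    intro w hw
    rw [mem_ball, dist_eq_norm]
    linarith [hball w hw]
  have hbound : ∀ w ∈ closedBall z ρ, ‖h w‖ ≤ 2 * M * R / ρ := by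
    intro w hw
    have hmaps : MapsTo (fun x ↦ c + x) (ball 0 R) (ball c R) := fun x hx ↦ by simpa using hx
    have h1 := borelCaratheodory_zero (f := fun x ↦ h (c + x)) (R := R) (z := w - c) hM
      (hhd.comp (by fun_prop) hmaps) (fun x hx ↦ hre _ (hmaps hx)) hR
      (by simpa [dist_eq_norm] using hin w hw) (by simpa using hhc)
    rw [add_sub_cancel] at h1
    have h2 := hball w hw
    refine h1.trans ?_
    gcongr <;> linarith
  have hzb : z ∈ ball c R := hin z (mem_closedBall_self hρ₀.le)
  have := norm_deriv_le_of_forall_mem_sphere_norm_le hρ₀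
    (hhd.mono fun w hw ↦ hin w ((closure_ball_subset_closedBall) hw)).diffContOnCl
    fun w hw ↦ hbound w (sphere_subset_closedBall hw)
  rw [(hh z hzb).deriv] at this
  refine this.trans_eq ?_
  rw [hρ]
  have : R - r ≠ 0 := by linarith
  field_simp
  ring

namespace DirichletCharacter

variable {N : ℕ} [NeZero N] {χ : DirichletCharacter ℂ N}

/-! ### Polynomial bound in the conductor -/

/-- Complete periods cancel by orthogonality, leaving fewer than `N` terms. This crude bound
suffices because only `log N` enters later. -/
theorem norm_sum_range_le (hχ : χ ≠ 1) (n : ℕ) :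
    ‖∑ k ∈ Finset.range n, χ k‖ ≤ N := by
  have hper (m : ℕ) : ∑ k ∈ Finset.range N, χ ((m * N + k : ℕ) : ZMod N) = 0 := by
    rw [← χ.sum_eq_zero_of_ne_one hχ]
    refine Finset.sum_bij' (fun k _ ↦ (k : ZMod N)) (fun a _ ↦ a.val) ?_ ?_ ?_ ?_ ?_
    · simp
    · intro a _
      simpa using a.val_lt
    · intro k hk
      exact ZMod.val_cast_of_lt (Finset.mem_range.mp hk)
    · simp
    · simp
  have hfull (m : ℕ) : ∑ k ∈ Finset.range (m * N), χ (k : ZMod N) = 0 := by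
    induction m with
    | zero => simp
    | succ m ih => rw [Nat.succ_mul, Finset.sum_range_add, ih, hper, add_zero]
  conv_lhs => rw [← Nat.div_add_mod' n N, Finset.sum_range_add, hfull, zero_add]
  calc _ ≤ ∑ k ∈ Finset.range (n % N), (1 : ℝ) :=
        norm_sum_le_of_le _ fun k _ ↦ χ.norm_le_one _
    _ ≤ N := by
        simpa using (Nat.mod_lt n (NeZero.pos N)).le

theorem norm_sum_Icc_le (hχ : χ ≠ 1) (n : ℕ) : ‖∑ k ∈ Finset.Icc 1 n, χ k‖ ≤ N := by
  have hN : χ ((0 : ℕ) : ZMod N) = 0 := by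
    have : Nontrivial (ZMod N) := by
      by_contra h
      rw [not_nontrivial_iff_subsingleton] at h
      exact hχ (by ext u; simp [Subsingleton.elim u 1])
    simp [χ.map_nonunit not_isUnit_zero]
  have h : ∑ k ∈ Finset.Icc 1 n, χ k = ∑ k ∈ Finset.range (n + 1), χ k := by
    rw [Finset.range_eq_Ico, Finset.sum_eq_sum_Ico_succ_bot (by lia), hN, zero_add]
    rfl
  rw [h]
  exact norm_sum_range_le hχ _

/-- Partial summation gives `L(s) = s ∫₁^∞ S(t) t^(-s-1) dt` for `Re s > 1`. As `S` is bounded, the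
integral is holomorphic on `Re s > 0`, and the identity theorem extends the formula. -/
theorem norm_LFunction_le (hχ : χ ≠ 1) {s : ℂ} (hs : 0 < s.re) :
    ‖LFunction χ s‖ ≤ ‖s‖ * N / s.re := by
  set S : ℝ → ℂ := fun t ↦ ∑ k ∈ Finset.Icc 1 ⌊t⌋₊, χ k with hS
  have hSb (t : ℝ) : ‖S t‖ ≤ N := norm_sum_Icc_le hχ _
  have hS0 {t : ℝ} (ht : t < 1) : S t = 0 := by simp [hS, Nat.floor_eq_zero.mpr ht]
  have hSm : Measurable S :=
    (measurable_from_nat (f := fun n : ℕ ↦ ∑ k ∈ Finset.Icc 1 n, χ k)).comp Nat.measurable_floor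
  have hloc : LocallyIntegrableOn S (Ioi 0) := by
    refine LocallyIntegrable.locallyIntegrableOn ?_ _
    refine (locallyIntegrable_const (N : ℝ)).mono hSm.aestronglyMeasurable ?_
    exact Eventually.of_forall fun t ↦ by simpa using hSb t
  have hmellin (z : ℂ) : mellin S (-z) = ∫ t in Ioi (1 : ℝ), S t * (t : ℂ) ^ (-(z + 1)) := by
    rw [mellin, ← integral_Ici_eq_integral_Ioi (x := (1 : ℝ)),
      ← integral_indicator measurableSet_Ioi, ← integral_indicator measurableSet_Ici]
    congr 1
    ext t
    by_cases ht : 1 ≤ t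
    · rw [indicator_of_mem (show t ∈ Ioi (0 : ℝ) from zero_lt_one.trans_le ht),
        indicator_of_mem (show t ∈ Ici (1 : ℝ) from ht), smul_eq_mul, mul_comm,
        show -(z + 1) = -z - 1 by ring]
    · rw [indicator_of_notMem (show t ∉ Ici (1 : ℝ) from ht)]
      simp [indicator, hS0 (not_le.mp ht)]
  have hdiff : DifferentiableOn ℂ (fun z ↦ z * mellin S (-z)) {z | 0 < z.re} := by
    intro z hz
    have hz' : 0 < z.re := hz
    have h1 : DifferentiableAt ℂ (mellin S) (-z) := by
      refine mellin_differentiableAt_of_isBigO_rpow (a := 0) (b := (-z).re - 1) hloc ?_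
        (by simpa using hz') ?_ (by linarith)
      · simp only [neg_zero, Real.rpow_zero]
        exact Asymptotics.isBigO_of_le' (c := N) _ fun t ↦ by simpa using hSb t
      · refine Asymptotics.IsBigO.of_bound 0 ?_
        have : Iio (1 : ℝ) ∈ 𝓝[>] (0 : ℝ) := mem_nhdsWithin_of_mem_nhds (Iio_mem_nhds one_pos)
        filter_upwards [this] with t ht
        simp [hS0 ht]
    exact (differentiableAt_id.mul (h1.comp z differentiableAt_id.neg)).differentiableWithinAt
  have hopen (a : ℝ) : IsOpen {z : ℂ | a < z.re} := isOpen_lt continuous_const continuous_re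
  have heq : EqOn (LFunction χ) (fun z ↦ z * mellin S (-z)) {z | 0 < z.re} := by
    refine AnalyticOnNhd.eqOn_of_preconnected_of_eventuallyEq (z₀ := 2)
      ((differentiable_LFunction hχ).differentiableOn.analyticOnNhd (hopen 0))
      (hdiff.analyticOnNhd (hopen 0)) (convex_halfSpace_re_gt 0).isPreconnected (by simp) ?_
    filter_upwards [(hopen 1).mem_nhds (show (1 : ℝ) < (2 : ℂ).re by simp)] with z hz
    have hz' : 1 < z.re := hz
    rw [LFunction_eq_LSeries χ hz', hmellin]
    refine LSeries_eq_mul_integral _ le_rfl (by linarith) (LSeriesSummable_of_one_lt_re χ hz') ?_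
    simp only [Real.rpow_zero]
    exact Asymptotics.isBigO_of_le' (c := N) _ fun n ↦ by simpa using norm_sum_Icc_le hχ n
  simp only [heq hs, hmellin, norm_mul, mul_div_assoc]
  gcongr
  have hlt : -(s.re + 1) < -1 := by linarith
  calc _ ≤ ∫ t in Ioi (1 : ℝ), N * t ^ (-(s.re + 1)) := by
        refine norm_integral_le_of_norm_le
          ((integrableOn_Ioi_rpow_of_lt hlt one_pos).const_mul _) ?_
        refine (ae_restrict_iff' measurableSet_Ioi).mpr (Eventually.of_forall fun t ht ↦ ?_)
        rw [norm_mul, norm_cpow_eq_rpow_re_of_pos (zero_lt_one.trans ht)]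
        have : (0 : ℝ) ≤ t := (zero_lt_one.trans ht).le
        simpa using by gcongr; exact hSb t
    _ = N / s.re := by
        rw [integral_const_mul, integral_Ioi_rpow_of_lt hlt one_pos, Real.one_rpow,
          show -(s.re + 1) + 1 = -s.re by ring, neg_div_neg_eq, mul_one_div]

/-! ### Bounds in the half-plane of absolute convergence -/

section AbsoluteConvergence

open scoped LSeries.notation ArithmeticFunction.Moebius ArithmeticFunction.vonMangoldt

/-- The series of `μχ` represents `1/L` and is dominated termwise by that of `ζ(2)`. -/
theorem exists_norm_inv_LFunction_le :
    ∃ B : ℝ, 1 ≤ B ∧ ∀ (N : ℕ) [NeZero N] (χ : DirichletCharacter ℂ N) (s : ℂ), s.re = 2 →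
      ‖(LFunction χ s)⁻¹‖ ≤ B := by
  refine ⟨max 1 (∑' n, ‖LSeries.term 1 2 n‖), le_max_left _ _, fun N _ χ s hs ↦ ?_⟩
  have hs1 : 1 < s.re := by rw [hs]; norm_num
  have hsum : Summable fun n ↦ ‖LSeries.term (1 : ℕ → ℂ) 2 n‖ :=
    (LSeriesSummable_one_iff.mpr (show 1 < (2 : ℂ).re by simp)).norm
  rw [LFunction_eq_LSeries χ hs1, inv_eq_of_mul_eq_one_right (LSeries.mul_mu_eq_one χ hs1)]
  refine le_max_of_le_right (tsum_of_norm_bounded hsum.hasSum fun n ↦ ?_)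
  refine (LSeries.norm_term_le (g := 1) s ?_).trans
    (LSeries.norm_term_le_of_re_le_re _ (by simp [hs]) n)
  simp only [Pi.mul_apply, norm_mul, Pi.one_apply, norm_one]
  refine mul_le_one₀ (χ.norm_le_one _) (norm_nonneg _) ?_
  exact_mod_cast ArithmeticFunction.abs_moebius_le_one

/-- The series of `χΛ` is dominated by `-ζ'/ζ` at `Re s`, whose only singularity on `[1, 3]` is a
simple pole at 1. The auxiliary function modulo 1 is `-ζ'/ζ` with that pole removed. -/
theorem exists_norm_logDeriv_LFunction_le :
    ∃ A : ℝ, 1 ≤ A ∧ ∀ (N : ℕ) [NeZero N] (χ : DirichletCharacter ℂ N) (s : ℂ), 1 < s.re →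
      s.re ≤ 3 → ‖deriv (LFunction χ) s / LFunction χ s‖ ≤ A / (s.re - 1) := by
  let F := ArithmeticFunction.vonMangoldt.LFunctionResidueClassAux (1 : ZMod 1)
  have hF : ContinuousOn (fun x : ℝ ↦ F x) (Icc 1 3) :=
    (ArithmeticFunction.vonMangoldt.continuousOn_LFunctionResidueClassAux (1 : ZMod 1)).comp
      continuous_ofReal.continuousOn fun x hx ↦ by simpa using hx.1
  obtain ⟨B, hB⟩ := isCompact_Icc.exists_bound_of_continuousOn hF
  have hB0 : 0 ≤ B := (norm_nonneg _).trans (hB 1 ⟨le_rfl, by norm_num⟩)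
  refine ⟨2 * B + 1, by linarith, fun N _ χ s hs hs3 ↦ ?_⟩
  set σ := s.re with hσ
  have hσ1 : 1 < (σ : ℂ).re := by simpa using hs
  have hΛ : LSeriesSummable ↗Λ σ := ArithmeticFunction.LSeriesSummable_vonMangoldt hσ1
  have hterm (n : ℕ) : LSeries.term ↗Λ σ n = ‖LSeries.term ↗Λ (σ : ℂ) n‖ := by
    rcases eq_or_ne n 0 with rfl | hn
    · simp
    · rw [LSeries.norm_term_eq, if_neg hn, LSeries.term_of_ne_zero hn, ofReal_div,
        ofReal_cpow (Nat.cast_nonneg n)]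
      simp [abs_of_nonneg ArithmeticFunction.vonMangoldt_nonneg]
  have h1 : ‖deriv (LFunction χ) s / LFunction χ s‖ ≤ ∑' n, ‖LSeries.term ↗Λ (σ : ℂ) n‖ := by
    rw [deriv_LFunction_eq_deriv_LSeries χ hs, LFunction_eq_LSeries χ hs, ← norm_neg, ← neg_div,
      ← LSeries_twist_vonMangoldt_eq χ hs]
    refine tsum_of_norm_bounded hΛ.norm.hasSum fun n ↦ ?_
    refine (LSeries.norm_term_le (g := ↗Λ) s ?_).trans
      (LSeries.norm_term_le_of_re_le_re _ (by simp [hσ]) n)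
    rw [Pi.mul_apply, norm_mul]
    exact mul_le_of_le_one_left (norm_nonneg _) (χ.norm_le_one n)
  have h2 : ‖LSeries ↗Λ σ‖ = ∑' n, ‖LSeries.term ↗Λ (σ : ℂ) n‖ := by
    rw [LSeries, tsum_congr hterm, ← ofReal_tsum, norm_real, Real.norm_of_nonneg]
    exact tsum_nonneg fun n ↦ norm_nonneg _
  have h3 : LSeries ↗Λ σ = F σ + 1 / (σ - 1) := by
    have := ArithmeticFunction.vonMangoldt.eqOn_LFunctionResidueClassAux (q := 1) isUnit_one hσ1
    have hres : ArithmeticFunction.vonMangoldt.residueClass (1 : ZMod 1) = ↑Λ := by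
      ext n
      simp [ArithmeticFunction.vonMangoldt.residueClass, indicator, Subsingleton.elim (n : ZMod 1) 1]
    simp only [hres] at this
    simp only [F, this]
    simp
  rw [← h2, h3] at h1
  have h4 : ‖(1 : ℂ) / (σ - 1)‖ = 1 / (σ - 1) := by
    rw [← ofReal_one, ← ofReal_sub, ← ofReal_div, norm_real, Real.norm_of_nonneg]
    exact div_nonneg zero_le_one (by linarith)
  refine h1.trans ((norm_add_le _ _).trans ?_)
  rw [h4, add_div]
  gcongr
  refine (hB σ ⟨hs.le, hs3⟩).trans ?_
  rw [le_div_iff₀ (by linarith)]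
  nlinarith

end AbsoluteConvergence

/-! ### Consequences of the Riemann hypothesis -/

theorem IsPrimitive.ne_one (hN : 1 < N) (hχ : χ.IsPrimitive) : χ ≠ 1 := by
  rintro rfl
  rw [isPrimitive_def, conductor_one] at hχ
  lia

theorem IsPrimitive.three_le (hN : 1 < N) (hχ : χ.IsPrimitive) : 3 ≤ N := by
  by_contra h
  obtain rfl : N = 2 := by lia
  refine hχ.ne_one hN ?_
  ext u
  have : u = 1 := by revert u; decide
  simp [this]

theorem LFunction_ne_zero_of_half_lt_re (hGRH : GeneralizedRiemannHypothesis) (hN : 1 < N)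
    (hχ : χ.IsPrimitive) {s : ℂ} (hs : 1 / 2 < s.re) : LFunction χ s ≠ 0 := by
  rcases lt_or_ge s.re 1 with h | h
  · intro h0
    exact hs.ne' (hGRH N χ hχ s (by linarith) h h0)
  · exact LFunction_ne_zero_of_one_le_re χ (.inl (hχ.ne_one hN)) h

theorem IsPrimitive.one_le_log (hN : 1 < N) (hχ : χ.IsPrimitive) : 1 ≤ Real.log N := by
  rw [Real.le_log_iff_exp_le (by positivity)]
  have : (3 : ℝ) ≤ N := mod_cast hχ.three_le hN
  linarith [Real.exp_one_lt_d9]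

/-- The logarithmic derivative is `O(log N)` in a disc reaching to the left of `Re s = 1`. -/
theorem exists_norm_logDeriv_LFunction_le_mul_log (hGRH : GeneralizedRiemannHypothesis) (T : ℝ) :
    ∃ K : ℝ, 1 ≤ K ∧ ∀ (N : ℕ) [NeZero N], 1 < N → ∀ χ : DirichletCharacter ℂ N, χ.IsPrimitive →
      ∀ c : ℂ, c.re = 2 → |c.im| ≤ T → ∀ z ∈ closedBall c (5 / 4),
        ‖deriv (LFunction χ) z / LFunction χ z‖ ≤ K * Real.log N := by
  obtain ⟨B, hB1, hB⟩ := exists_norm_inv_LFunction_le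
  set D := 2 * (|T| + 4) * B with hD
  have hD1 : 1 ≤ D := by nlinarith [abs_nonneg T]
  have hlogD : 0 ≤ Real.log D := Real.log_nonneg hD1
  -- `192 = 8 · (3/2) / (3/2 - 5/4)²`, from `norm_deriv_div_le_of_ball`.
  refine ⟨192 * (Real.log D + 1), by linarith, fun N _ hN χ hχ c hc hcT z hz ↦ ?_⟩
  have hlog := hχ.one_le_log hN
  have hdiff := differentiable_LFunction (hχ.ne_one hN)
  have hre : ∀ w ∈ ball c (3 / 2), 1 / 2 < w.re := by
    intro w hw
    have h1 := (abs_re_le_norm (w - c)).trans_lt (mem_ball_iff_norm.mp hw)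
    rw [sub_re, hc, abs_lt] at h1
    linarith [h1.1]
  have hNpos : (0 : ℝ) < N := by exact_mod_cast NeZero.pos N
  have hc0 : LFunction χ c ≠ 0 :=
    LFunction_ne_zero_of_half_lt_re hGRH hN hχ (by rw [hc]; norm_num)
  have hbound : ∀ w ∈ ball c (3 / 2),
      ‖LFunction χ w‖ ≤ Real.exp ((Real.log D + 1) * Real.log N) * ‖LFunction χ c‖ := by
    intro w hw
    have h1 := norm_LFunction_le (hχ.ne_one hN) (by linarith [hre w hw] : 0 < w.re)
    have h2 : ‖w‖ ≤ |T| + 4 := by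
      have h3 : ‖w‖ ≤ ‖w - c‖ + ‖c‖ := norm_le_norm_sub_add w c
      have h4 := norm_le_abs_re_add_abs_im c
      rw [hc, abs_two] at h4
      linarith [mem_ball_iff_norm.mp hw, le_abs_self T]
    have h3 : ‖w‖ * N / w.re ≤ 2 * (|T| + 4) * N := by
      rw [div_le_iff₀ (by linarith [hre w hw])]
      have : 0 ≤ (|T| + 4) * N := by positivity
      nlinarith [hre w hw, mul_le_mul_of_nonneg_right h2 hNpos.le]
    have h4 : 1 ≤ B * ‖LFunction χ c‖ := by
      have := hB N χ c hc
      rwa [norm_inv, inv_le_iff_one_le_mul₀ (norm_pos_iff.mpr hc0)] at this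
    have h5 : D * N ≤ Real.exp ((Real.log D + 1) * Real.log N) := by
      rw [add_mul, one_mul, Real.exp_add, Real.exp_log hNpos]
      gcongr
      rw [← Real.log_le_iff_le_exp (by positivity)]
      nlinarith
    calc ‖LFunction χ w‖ ≤ 2 * (|T| + 4) * N := h1.trans h3
      _ ≤ 2 * (|T| + 4) * N * (B * ‖LFunction χ c‖) := le_mul_of_one_le_right (by positivity) h4
      _ = D * N * ‖LFunction χ c‖ := by rw [hD]; ring
      _ ≤ _ := by gcongr
  refine (norm_deriv_div_le_of_ball (R := 3 / 2) hdiff.differentiableOn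
    (fun w hw ↦ LFunction_ne_zero_of_half_lt_re hGRH hN hχ (hre w hw)) (by positivity) hbound
    (by norm_num) (by norm_num) hz).trans_eq ?_
  ring

/-- The logarithmic derivative is `O(log log N)` within `1 / log log N` of `Re s = 1`. -/
theorem exists_norm_logDeriv_LFunction_le_loglog (hGRH : GeneralizedRiemannHypothesis) (T : ℝ) :
    ∃ C : ℝ, 1 ≤ C ∧ ∀ (N : ℕ) [NeZero N], 1 < N → ∀ χ : DirichletCharacter ℂ N, χ.IsPrimitive →
      ∀ s : ℂ, |s.re - 1| ≤ (8 + Real.log (Real.log N))⁻¹ → |s.im| ≤ T →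
        ‖deriv (LFunction χ) s / LFunction χ s‖ ≤ C * (8 + Real.log (Real.log N)) := by
  obtain ⟨A, hA1, hA⟩ := exists_norm_logDeriv_LFunction_le
  obtain ⟨K, hK1, hK⟩ := exists_norm_logDeriv_LFunction_le_mul_log hGRH T
  refine ⟨A * (K ^ (2 : ℝ) * Real.exp 12), ?_, fun N _ hN χ hχ s hs hsT ↦ ?_⟩
  · exact one_le_mul_of_one_le_of_one_le hA1 (one_le_mul_of_one_le_of_one_le
      (Real.one_le_rpow hK1 (by norm_num)) (Real.one_le_exp (by norm_num)))
  have hlog := hχ.one_le_log hN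
  have hll : 0 ≤ Real.log (Real.log N) := Real.log_nonneg hlog
  set ℓ := Real.log (Real.log N) with hℓ
  -- The 8 forces `δ ≤ 1/8`, keeping `s` inside the outer circle; `δ * ℓ ≤ 1` keeps `(log N)^(12δ)`
  -- below `e^12`.
  set δ := (8 + ℓ)⁻¹ with hδ
  have hδ0 : 0 < δ := by positivity
  have hδ8 : δ ≤ 1 / 8 := by
    rw [hδ, one_div]
    gcongr
    linarith
  have hδℓ : δ * ℓ ≤ 1 := by
    rw [hδ, inv_mul_le_iff₀ (by positivity)]
    linarith
  set c : ℂ := 2 + s.im * I with hc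
  have hcre : c.re = 2 := by simp [hc]
  have hcim : c.im = s.im := by simp [hc]
  have hsc : ‖s - c‖ = 2 - s.re := by
    have : s - c = ((s.re - 2 : ℝ) : ℂ) := by
      apply Complex.ext <;> simp [hcre, hcim]
    rw [this, norm_real, Real.norm_eq_abs, abs_of_nonpos] <;> linarith [(abs_le.mp hs).2]
  obtain ⟨hs1, hs2⟩ := abs_le.mp hs
  have hre : ∀ z ∈ closedBall c (5 / 4), 1 / 2 < z.re := by
    intro w hw
    have h1 := (abs_re_le_norm (w - c)).trans (mem_closedBall_iff_norm.mp hw)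
    rw [sub_re, hcre, abs_le] at h1
    linarith [h1.1]
  have hdiff : DifferentiableOn ℂ (fun z ↦ deriv (LFunction χ) z / LFunction χ z)
      (closedBall c (5 / 4)) := by
    have hd := differentiable_LFunction (hχ.ne_one hN)
    exact hd.deriv.differentiableOn.div hd.differentiableOn fun z hz ↦
      LFunction_ne_zero_of_half_lt_re hGRH hN hχ (hre z hz)
  have ha : ∀ z ∈ sphere c (1 - δ), ‖deriv (LFunction χ) z / LFunction χ z‖ ≤ A / δ := by
    intro z hz
    have h1 := (abs_re_le_norm (z - c)).trans_eq (mem_sphere_iff_norm.mp hz)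
    rw [sub_re, hcre, abs_le] at h1
    refine (hA N χ z (by linarith) (by linarith)).trans ?_
    gcongr
    linarith
  have hb : ∀ z ∈ sphere c (5 / 4),
      ‖deriv (LFunction χ) z / LFunction χ z‖ ≤ K * Real.log N :=
    fun z hz ↦ hK N hN χ hχ c hcre (by rwa [hcim]) z (sphere_subset_closedBall hz)
  have key := norm_le_of_three_circles hdiff (by linarith) (by linarith) ha hb
    (z := s) (by rw [hsc]; linarith) (by rw [hsc]; linarith)
  rw [hsc] at key
  set θ := Real.log ((2 - s.re) / (1 - δ)) / Real.log (5 / 4 / (1 - δ)) with hθ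
  have hδ1 : 0 < 1 - δ := by linarith
  have hnum0 : 0 ≤ Real.log ((2 - s.re) / (1 - δ)) :=
    Real.log_nonneg ((one_le_div hδ1).mpr (by linarith))
  have hden : 1 / 5 ≤ Real.log (5 / 4 / (1 - δ)) := by
    have h1 := Real.one_sub_inv_le_log_of_pos (show (0 : ℝ) < 5 / 4 by norm_num)
    refine (by norm_num at h1 ⊢; exact h1 : (1 : ℝ) / 5 ≤ Real.log (5 / 4)).trans ?_
    refine Real.log_le_log (by norm_num) ?_
    rw [le_div_iff₀ hδ1]
    linarith
  have hnum : Real.log ((2 - s.re) / (1 - δ)) ≤ 12 / 5 * δ := by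
    have h1 := Real.log_le_sub_one_of_pos
      (show 0 < (2 - s.re) / (1 - δ) from div_pos (by linarith) hδ1)
    refine h1.trans ?_
    rw [sub_le_iff_le_add, div_le_iff₀ hδ1]
    nlinarith
  have hθ0 : 0 ≤ θ := div_nonneg hnum0 (by linarith)
  have hθ12 : θ ≤ 12 * δ := by
    rw [hθ, div_le_iff₀ (by linarith)]
    nlinarith
  have hAδ : 1 ≤ A / δ := (one_le_div hδ0).mpr (by linarith)
  have h1 : (A / δ) ^ (1 - θ) ≤ A / δ := by
    conv_rhs => rw [← Real.rpow_one (A / δ)]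
    exact Real.rpow_le_rpow_of_exponent_le hAδ (by linarith)
  -- Here `θ ≤ 12δ ≤ 3/2`, so `K ^ θ ≤ K ^ 2`.
  have h2 : (K * Real.log N) ^ θ ≤ K ^ (2 : ℝ) * Real.exp 12 := by
    rw [Real.mul_rpow (by linarith) (by linarith)]
    gcongr
    · linarith
    · rw [Real.rpow_def_of_pos (by linarith), ← hℓ]
      gcongr
      nlinarith
  calc _ ≤ _ := key
    _ ≤ A / δ * (K ^ (2 : ℝ) * Real.exp 12) := by gcongr
    _ = _ := by rw [hδ, div_inv_eq_mul]; ring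

theorem IsPrimitive.log_log_three_le (hN : 1 < N) (hχ : χ.IsPrimitive) :
    Real.log (Real.log 3) ≤ Real.log (Real.log N) := by
  have h3 : (3 : ℝ) ≤ N := mod_cast hχ.three_le hN
  exact Real.log_le_log (Real.log_pos (by norm_num)) (Real.log_le_log (by norm_num) h3)

end DirichletCharacter

theorem Real.log_log_three_pos : 0 < Real.log (Real.log 3) := by
  refine Real.log_pos ?_
  rw [Real.lt_log_iff_exp_lt (by norm_num)]
  linarith [Real.exp_one_lt_d9]

open DirichletCharacter

theorem mainTheorem3 (hGRH : GeneralizedRiemannHypothesis) (T : ℝ) :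
    (∃ C : ℝ, ∀ (N : ℕ) [NeZero N], 1 < N →
      ∀ χ : DirichletCharacter ℂ N, χ.IsPrimitive →
        ∀ s : ℂ, s.re = 1 → |s.im| ≤ T →
          ‖deriv (DirichletCharacter.LFunction χ) s / DirichletCharacter.LFunction χ s‖
            ≤ C * Real.log (Real.log N)) ∧
    (∀ ε : ℝ, 0 < ε → ∃ C : ℝ, ∀ (N : ℕ) [NeZero N], 1 < N →
      ∀ χ : DirichletCharacter ℂ N, χ.IsPrimitive →
        ∀ s : ℂ, s.re = 1 → |s.im| ≤ T →
          ‖iteratedDeriv 2 (DirichletCharacter.LFunction χ) s / DirichletCharacter.LFunction χ s‖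
            ≤ C * Real.log (Real.log N) ^ (3 + ε)) := by
  -- `T + 1` leaves room for the Cauchy disc about `s`.
  obtain ⟨C, hC1, hC⟩ := exists_norm_logDeriv_LFunction_le_loglog hGRH (T + 1)
  set ℓ₀ := Real.log (Real.log 3)
  have hℓ₀ : 0 < ℓ₀ := Real.log_log_three_pos
  have hlin {x : ℝ} (hx : ℓ₀ ≤ x) : 8 + x ≤ (8 / ℓ₀ + 1) * x := by
    have : 8 ≤ 8 / ℓ₀ * x := by
      rw [div_mul_eq_mul_div, le_div_iff₀ hℓ₀]
      linarith
    linarith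
  refine ⟨⟨C * (8 / ℓ₀ + 1), fun N _ hN χ hχ s hs hsT ↦ ?_⟩, fun ε hε ↦
    ⟨(C + C ^ 2) * (8 / ℓ₀ + 1) ^ 2 / ℓ₀ ^ (1 + ε), fun N _ hN χ hχ s hs hsT ↦ ?_⟩⟩
  · have hℓ := hχ.log_log_three_le hN
    have : 0 ≤ Real.log (Real.log N) := hℓ₀.le.trans hℓ
    refine (hC N hN χ hχ s (by rw [hs, sub_self, abs_zero]; positivity) (by linarith)).trans ?_
    rw [mul_assoc]
    gcongr
    exact hlin hℓ
  have hℓ := hχ.log_log_three_le hN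
  set ℓ := Real.log (Real.log N)
  have hℓpos : 0 < ℓ := hℓ₀.trans_le hℓ
  have hδ : 0 < (8 + ℓ)⁻¹ := by positivity
  have hδ1 : (8 + ℓ)⁻¹ ≤ 1 / 8 := by
    rw [one_div]
    gcongr
    linarith
  have hd := differentiable_LFunction (hχ.ne_one hN)
  have hnear : ∀ z ∈ closedBall s (8 + ℓ)⁻¹, |z.re - 1| ≤ (8 + ℓ)⁻¹ ∧ |z.im| ≤ T + 1 := by
    intro z hz
    have hz' := mem_closedBall_iff_norm.mp hz
    have h1 := (abs_re_le_norm (z - s)).trans hz'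
    have h2 := (abs_im_le_norm (z - s)).trans hz'
    rw [sub_re, hs] at h1
    rw [sub_im] at h2
    exact ⟨h1, by linarith [abs_sub_abs_le_abs_sub z.im s.im]⟩
  have hne : ∀ z ∈ closedBall s (8 + ℓ)⁻¹, LFunction χ z ≠ 0 := fun z hz ↦
    LFunction_ne_zero_of_half_lt_re hGRH hN hχ (by linarith [(abs_le.mp (hnear z hz).1).1])
  have hss : s ∈ closedBall s (8 + ℓ)⁻¹ := mem_closedBall_self hδ.le
  have hf : ‖deriv (LFunction χ) s / LFunction χ s‖ ≤ C * (8 + ℓ) :=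
    hC N hN χ hχ s (hnear s hss).1 (hnear s hss).2
  have hf' : ‖deriv (fun z ↦ deriv (LFunction χ) z / LFunction χ z) s‖
      ≤ C * (8 + ℓ) / (8 + ℓ)⁻¹ := by
    refine norm_deriv_le_of_forall_mem_sphere_norm_le hδ ?_ fun z hz ↦ ?_
    · refine DifferentiableOn.diffContOnCl ?_
      exact hd.deriv.differentiableOn.div hd.differentiableOn fun z hz ↦
        hne z (closure_ball_subset_closedBall hz)
    · have hz' := hnear z (sphere_subset_closedBall hz)
      exact hC N hN χ hχ z hz'.1 hz'.2
  have hsplit : iteratedDeriv 2 (LFunction χ) s / LFunction χ s =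
      deriv (fun z ↦ deriv (LFunction χ) z / LFunction χ z) s +
        (deriv (LFunction χ) s / LFunction χ s) ^ 2 := by
    have h0 := hne s hss
    rw [deriv_fun_div hd.deriv.differentiableAt hd.differentiableAt h0, iteratedDeriv_succ,
      iteratedDeriv_one]
    field_simp
    ring
  -- The surplus power `1 + ε` is harmless because `ℓ ≥ ℓ₀ > 0`.
  have hpow : ℓ ^ 2 ≤ ℓ ^ (3 + ε) / ℓ₀ ^ (1 + ε) := by
    rw [le_div_iff₀ (by positivity), show 3 + ε = 2 + (1 + ε) by ring, Real.rpow_add hℓpos,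
      Real.rpow_two]
    gcongr
  rw [hsplit]
  calc _ ≤ C * (8 + ℓ) / (8 + ℓ)⁻¹ + (C * (8 + ℓ)) ^ 2 := by
        refine (norm_add_le _ _).trans (add_le_add hf' ?_)
        rw [norm_pow]
        gcongr
    _ = (C + C ^ 2) * (8 + ℓ) ^ 2 := by
        rw [div_inv_eq_mul]
        ring
    _ ≤ (C + C ^ 2) * ((8 / ℓ₀ + 1) * ℓ) ^ 2 := by
        gcongr
        exact hlin hℓ
    _ = (C + C ^ 2) * (8 / ℓ₀ + 1) ^ 2 * ℓ ^ 2 := by ring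
    _ ≤ (C + C ^ 2) * (8 / ℓ₀ + 1) ^ 2 * (ℓ ^ (3 + ε) / ℓ₀ ^ (1 + ε)) := by gcongr
    _ = _ := by ring
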